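/- Let $F$ be a probability distribution on $\mathbb{R}$ and let $x\sim F$, with $\mathbb{E}(x)=0$, $0<\mathrm{Var}(x)<\infty$ and $\mathbb{E}(|x|^3)<\infty$. A design function is a measurable $p:\mathbb{R}\to[0,1]$; under $p$, the pair $(x,z)$ has $x\sim F$ and, given $x$, $z=1$ with probability $p(x)$ and $z=-1$ with probability $1-p(x)$, and $\mathbb{E}_p$ denotes the expectation for this joint law. For $\sigma>0$ the expected information matrix of $p$ is $$\mathcal{I}(p)=\sigma^{-2}\,\mathbb{E}_p(XX^{\top})\in\mathbb{R}^{4\times4},\qquad X=(1,x,z,xz)^{\top}.$$ For $\tilde z\in(-1,1)$ let $\widetilde{xz}_{\max}(\tilde z)$ be the maximum of $\mathbb{E}_p(xz)$ over all design functions $p$ with $\mathbb{E}_p(z)=\tilde z$, and let $$\mathcal{J}=\{(\tilde z,\widetilde{xz}) : -1<\tilde z<1,\ 0\le\widetilde{xz}\le\widetilde{xz}_{\max}(\tilde z)\}.$$ Let $\Psi$ be an efficiency criterion, i.e. a function of $4\times4$ real matrices with values in $[-\infty,\infty]$, which is continuous on the set of information matrices $\mathcal{I}(p)$ of design functions $p$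 with $(\mathbb{E}_p(z),\mathbb{E}_p(xz))\in\mathcal{J}$ (in particular, $\Psi$ may be any continuous real-valued function of the matrix). Then for every $(\tilde z,\widetilde{xz})\in\mathcal{J}$ the problem $$\text{maximize } \Psi(\mathcal{I}(p))\ \text{ over monotone (nondecreasing) design functions } p\ \text{ subject to } \mathbb{E}_p(z)=\tilde z \text{ and } \mathbb{E}_p(xz)=\widetilde{xz}$$ has a solution $p$ such that, for some $0\le\ell'\le u'\le1$ and $t'\in\mathbb{R}$, $$p(x)=\ell'\ \text{ for all } x<t',\qquad p(x)=u'\ \text{ for all } x>t'.$$ (The value $p(t')$ is not specified.) -/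

import Mathlib

open MeasureTheory ProbabilityTheory Set

noncomputable section

namespace TieBreaker

/-- The standing assumption on the distribution `F` of the running variable `x`:
`0 < Var(x) < ∞` and `E(x) = 0`. -/
structure IsRunningDist (F : Measure ℝ) : Prop where
  prob : IsProbabilityMeasure F
  memLp_two : MemLp (fun x : ℝ => x) 2 F
  mean_zero : ∫ x, x ∂F = 0
  variance_pos : 0 < variance (fun x : ℝ => x) F

/-- A design function: a measurable `p : ℝ → [0, 1]`, where `p x = Pr(z = 1 | x)`. -/
structure IsDesign (p : ℝ → ℝ) : Prop where
  measurable : Measurable p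
  mem_Icc : ∀ x, p x ∈ Icc (0 : ℝ) 1

/-- The class of monotone (nondecreasing) design functions. -/
def monotoneDesigns : Set (ℝ → ℝ) := {p | IsDesign p ∧ Monotone p}

/-- The joint law of `(x, z)`, with `x ∼ F` and, given `x`, `z = 1` with probability `p x` and
`z = -1` with probability `1 - p x`. -/
def jointLaw (F : Measure ℝ) (p : ℝ → ℝ) : Measure (ℝ × ℝ) :=
  (F.withDensity fun x => ENNReal.ofReal (p x)).map (fun x => (x, (1 : ℝ))) +
    (F.withDensity fun x => ENNReal.ofReal (1 - p x)).map (fun x => (x, (-1 : ℝ)))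

/-- `E_p(x ^ a * z)`. -/
def momentZ (F : Measure ℝ) (p : ℝ → ℝ) (a : ℕ) : ℝ :=
  ∫ w, w.1 ^ a * w.2 ∂(jointLaw F p)

/-- The covariate vector `(1, x, z, x z)` of the two-line model
`y = β₀ + β₁ x + β₂ z + β₃ x z + ε`. -/
def covariates (x z : ℝ) : Fin 4 → ℝ := ![1, x, z, x * z]

/-- The expected information matrix `σ⁻² E_p(X Xᵀ)`, where `X = (1, x, z, x z)` and
`σ²` is the variance of the errors. -/
def infoMatrix (F : Measure ℝ) (σ : ℝ) (p : ℝ → ℝ) : Matrix (Fin 4) (Fin 4) ℝ :=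
  Matrix.of fun i j =>
    (σ ^ 2)⁻¹ * ∫ w, covariates w.1 w.2 i * covariates w.1 w.2 j ∂(jointLaw F p)

/-- The largest value of `E_p(x z)` over all design functions `p` with `E_p(z) = zt`. -/
def xzMax (F : Measure ℝ) (zt : ℝ) : ℝ :=
  sSup {y | ∃ p, IsDesign p ∧ momentZ F p 0 = zt ∧ momentZ F p 1 = y}

/-- The feasible input space of pairs `(zt, xzt)`. -/
def feasibleInputs (F : Measure ℝ) : Set (ℝ × ℝ) :=
  {c | -1 < c.1 ∧ c.1 < 1 ∧ 0 ≤ c.2 ∧ c.2 ≤ xzMax F c.1}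

/-- The information matrices of the input-feasible designs, i.e. of the design functions whose
pair of moments `(E_p(z), E_p(x z))` lies in the feasible input space. -/
def inputFeasibleMatrices (F : Measure ℝ) (σ : ℝ) : Set (Matrix (Fin 4) (Fin 4) ℝ) :=
  {A | ∃ p, IsDesign p ∧ (momentZ F p 0, momentZ F p 1) ∈ feasibleInputs F ∧
    A = infoMatrix F σ p}

/-- `p` belongs to the class `𝓕` and satisfies `E_p(z) = zt` and `E_p(x z) = xzt`. -/
def IsFeasible (F : Measure ℝ) (𝓕 : Set (ℝ → ℝ)) (zt xzt : ℝ) (p : ℝ → ℝ) : Prop :=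
  p ∈ 𝓕 ∧ momentZ F p 0 = zt ∧ momentZ F p 1 = xzt

/-- `p` solves the design problem: maximize `Ψ (infoMatrix F σ q)` over `q ∈ 𝓕` subject to
`E_q(z) = zt` and `E_q(x z) = xzt`. -/
def IsOptimal (F : Measure ℝ) (σ : ℝ) (Ψ : Matrix (Fin 4) (Fin 4) ℝ → EReal)
    (𝓕 : Set (ℝ → ℝ)) (zt xzt : ℝ) (p : ℝ → ℝ) : Prop :=
  IsFeasible F 𝓕 zt xzt p ∧
    ∀ q, IsFeasible F 𝓕 zt xzt q → Ψ (infoMatrix F σ q) ≤ Ψ (infoMatrix F σ p)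

end TieBreaker

end

/-!
# Optimality of two-level tie-breaker designs among monotone designs

Since `z ^ 2 = 1`, the information matrix of a design depends on `p` only through `E_p(z)`,
`E_p(x z)` and `E_p(x ^ 2 z)` (`infoMatrix_eq`). The constraints fix the first two of them,
equivalently `∫ p = c` and `∫ x p = m`, so it suffices to produce a compact, connected set of
two-level designs that realizes every value of `∫ x ^ 2 p` taken by a feasible monotone `p`.

Let `h s` be the threshold function of mean `s`, with a possible atom at the threshold split so that
`h s` increases with `s`, and let `G s = ∫ x h s`. For `m > 0` the only two-level function
that jumps where `h s` does and has the right moments is `c + (m / G s) (h s - s)` (`twoLevel`).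
As `G s / s` is nonincreasing and `G s / (1 - s)` nondecreasing, its levels lie in `[0, 1]` for all
`s` in an interval `[a, b]` around `c`, whose ends are found by the intermediate value theorem
such that the upper level is `1` at `a` and the lower level is `0` at `b`
(`IsThresholdFamily.exists_parameter_interval`). That `s = c` is admissible, `m ≤ G c`, is the
constraint `xzt ≤ xzMax F zt`, because thresholds maximize `∫ x p` at a given mean.

A monotone `p` with the same moments differs from the two-level design at `b` by a function with
signs `+, -, +`. Multiplying by the quadratic polynomial with zeros at the sign changes shows that
the design at `b` has the least second moment; likewise the design at `a` has the greatest
(`moment_two_le_of_left_eq_zero`, `moment_two_le_of_right_eq_one`). Moments of `h s` are continuous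
in `s`, so every feasible monotone design shares its information matrix with the two-level design
at some `s ∈ [a, b]`, and the continuous criterion attains its maximum over `[a, b]`. For `m = 0`,
monotonicity forces `p` to be constant almost everywhere.
-/

namespace TieBreaker

open Filter Topology

variable {F : Measure ℝ} {p q : ℝ → ℝ} {h : ℝ → ℝ → ℝ}

/-! ### Moments of a design and its information matrix -/

/-- The `k`-th moment `∫ x ^ k * p x ∂F` of a function `p` with respect to `F`. -/
noncomputable def moment (F : Measure ℝ) (p : ℝ → ℝ) (k : ℕ) : ℝ := ∫ x, x ^ k * p x ∂F

theorem IsRunningDist.integrable_pow (hF : IsRunningDist F) {k : ℕ} (hk : k ≤ 2) :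
    Integrable (fun x : ℝ => x ^ k) F := by
  have := hF.prob
  interval_cases k
  · simp
  · simpa using hF.memLp_two.integrable one_le_two
  · exact hF.memLp_two.integrable_sq

theorem IsDesign.abs_le_one (hp : IsDesign p) (x : ℝ) : |p x| ≤ 1 :=
  abs_le.2 ⟨by linarith [(hp.mem_Icc x).1], (hp.mem_Icc x).2⟩

theorem integrable_pow_mul (hF : IsRunningDist F) (hp : IsDesign p) {k : ℕ} (hk : k ≤ 2) :
    Integrable (fun x : ℝ => x ^ k * p x) F :=
  (hF.integrable_pow hk).mul_bdd hp.measurable.aestronglyMeasurable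
    (ae_of_all _ fun x => by simpa using hp.abs_le_one x)

theorem integral_jointLaw (hp : IsDesign p) {f : ℝ × ℝ → ℝ} (hf : Measurable f)
    (h1 : Integrable (fun x => f (x, 1)) F) (h2 : Integrable (fun x => f (x, -1)) F) :
    ∫ w, f w ∂(jointLaw F p) = ∫ x, (p x * f (x, 1) + (1 - p x) * f (x, -1)) ∂F := by
  have key : ∀ (r : ℝ → ℝ) (z : ℝ), Measurable r → (∀ x, r x ∈ Icc (0 : ℝ) 1) →
      Integrable (fun x => f (x, z)) F →
      Integrable f ((F.withDensity fun x => ENNReal.ofReal (r x)).map (fun x => (x, z))) ∧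
      ∫ w, f w ∂((F.withDensity fun x => ENNReal.ofReal (r x)).map (fun x => (x, z))) =
        ∫ x, r x * f (x, z) ∂F ∧ Integrable (fun x => r x * f (x, z)) F := by
    intro r z hr hr' hi
    have hm : Measurable fun x : ℝ => (x, z) := by fun_prop
    have hint : Integrable (fun x => r x * f (x, z)) F :=
      hi.bdd_mul (c := 1) hr.aestronglyMeasurable (ae_of_all _ fun x => by
        rw [Real.norm_eq_abs, abs_of_nonneg (hr' x).1]; exact (hr' x).2)
    have e : ∀ x, (ENNReal.ofReal (r x)).toReal • f (x, z) = r x * f (x, z) := fun x => by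
      rw [ENNReal.toReal_ofReal (hr' x).1, smul_eq_mul]
    have hlt : ∀ᵐ x ∂F, ENNReal.ofReal (r x) < ⊤ := ae_of_all _ fun x => ENNReal.ofReal_lt_top
    refine ⟨?_, ?_, hint⟩
    · rw [integrable_map_measure hf.aestronglyMeasurable hm.aemeasurable,
        integrable_withDensity_iff_integrable_smul' hr.ennreal_ofReal hlt]
      simpa only [Function.comp, e] using hint
    · rw [integral_map hm.aemeasurable hf.aestronglyMeasurable,
        integral_withDensity_eq_integral_toReal_smul hr.ennreal_ofReal hlt]
      simp only [e]
  obtain ⟨a1, a2, a3⟩ := key p 1 hp.measurable hp.mem_Icc h1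
  obtain ⟨b1, b2, b3⟩ := key (fun x => 1 - p x) (-1) (measurable_const.sub hp.measurable)
    (fun x => ⟨by linarith [(hp.mem_Icc x).2], by linarith [(hp.mem_Icc x).1]⟩) h2
  rw [jointLaw, integral_add_measure a1 b1, a2, b2, integral_add a3 b3]

theorem momentZ_eq (hF : IsRunningDist F) (hp : IsDesign p) {k : ℕ} (hk : k ≤ 2) :
    momentZ F p k = 2 * moment F p k - ∫ x, x ^ k ∂F := by
  have hi := hF.integrable_pow hk
  rw [momentZ, integral_jointLaw hp (by fun_prop) (by simpa using hi) (by simpa using hi.neg),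
    moment, ← integral_const_mul,
    ← integral_sub ((integrable_pow_mul hF hp hk).const_mul 2) hi]
  exact integral_congr_ae (ae_of_all _ fun x => by ring)

theorem integral_jointLaw_mul_sq (hF : IsRunningDist F) (hp : IsDesign p) {k n : ℕ}
    (hk : k ≤ 2) (hn : Even n) :
    ∫ w, w.1 ^ k * w.2 ^ n ∂(jointLaw F p) = ∫ x, x ^ k ∂F := by
  have hi := hF.integrable_pow hk
  rw [integral_jointLaw hp (by fun_prop) (by simpa using hi) (by simpa [hn.neg_one_pow] using hi)]
  refine integral_congr_ae (ae_of_all _ fun x => ?_)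
  simp only [one_pow, hn.neg_one_pow]
  ring

/-- The information matrix as a function of the moments `m k = E_p(x ^ k * z)`, `k ≤ 2`. -/
noncomputable def momentMatrix (F : Measure ℝ) (σ m₀ m₁ m₂ : ℝ) : Matrix (Fin 4) (Fin 4) ℝ :=
  let e : ℕ → ℝ := fun k => ∫ x, x ^ k ∂F
  (σ ^ 2)⁻¹ • !![e 0, e 1, m₀, m₁; e 1, e 2, m₁, m₂; m₀, m₁, e 0, e 1; m₁, m₂, e 1, e 2]

theorem continuous_momentMatrix (σ m₀ m₁ : ℝ) : Continuous (momentMatrix F σ m₀ m₁) := by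
  refine continuous_matrix fun i j => ?_
  fin_cases i <;> fin_cases j <;> simp [momentMatrix] <;> fun_prop

theorem infoMatrix_eq (hF : IsRunningDist F) (hp : IsDesign p) (σ : ℝ) :
    infoMatrix F σ p =
      momentMatrix F σ (momentZ F p 0) (momentZ F p 1) (momentZ F p 2) := by
  have e (k n : ℕ) (hk : k ≤ 2) (hn : Even n) := integral_jointLaw_mul_sq hF hp hk hn
  have e0 := e 0 0 (by simp) (by simp)
  have e1 := e 1 0 (by simp) (by simp)
  have e2 := e 2 0 (by simp) (by simp)
  have f0 := e 0 2 (by simp) (by simp)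
  have f1 := e 1 2 (by simp) (by simp)
  have f2 := e 2 2 (by simp) (by simp)
  ext i j
  fin_cases i <;> fin_cases j <;>
    simp only [infoMatrix, momentMatrix, covariates, Matrix.of_apply, Matrix.smul_apply,
      smul_eq_mul] <;>
    refine congrArg _ ?_
  · exact (integral_congr_ae (ae_of_all _ fun w => by simp)).trans e0
  · exact (integral_congr_ae (ae_of_all _ fun w => by simp)).trans e1
  · exact integral_congr_ae (ae_of_all _ fun w => by simp)
  · exact integral_congr_ae (ae_of_all _ fun w => by simp)
  · exact (integral_congr_ae (ae_of_all _ fun w => by simp)).trans e1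
  · exact (integral_congr_ae (ae_of_all _ fun w => by simp; ring)).trans e2
  · exact integral_congr_ae (ae_of_all _ fun w => by simp)
  · exact integral_congr_ae (ae_of_all _ fun w => by simp; ring)
  · exact integral_congr_ae (ae_of_all _ fun w => by simp)
  · exact integral_congr_ae (ae_of_all _ fun w => by simp; ring)
  · exact (integral_congr_ae (ae_of_all _ fun w => by simp; ring)).trans f0
  · exact (integral_congr_ae (ae_of_all _ fun w => by simp; ring)).trans f1
  · exact integral_congr_ae (ae_of_all _ fun w => by simp)
  · exact integral_congr_ae (ae_of_all _ fun w => by simp; ring)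
  · exact (integral_congr_ae (ae_of_all _ fun w => by simp; ring)).trans f1
  · exact (integral_congr_ae (ae_of_all _ fun w => by simp; ring)).trans f2

/-! ### Threshold functions -/

/-- `h` is a nondecreasing design function that jumps from `0` to `1` at `t`; `h t` is free. -/
structure IsThreshold (h : ℝ → ℝ) (t : ℝ) : Prop where
  monotone : Monotone h
  mem_Icc : ∀ x, h x ∈ Icc (0 : ℝ) 1
  left : ∀ x, x < t → h x = 0
  right : ∀ x, t < x → h x = 1

/-- A probability distribution has a threshold function of every mean in `(0, 1)`: `t` is a
quantile, and the value at `t` splits a possible atom. -/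
theorem exists_isThreshold (hF : IsProbabilityMeasure F) {s : ℝ} (h0 : 0 < s) (h1 : s < 1) :
    ∃ h t, IsThreshold h t ∧ ∫ x, h x ∂F = s := by
  set A : Set ℝ := {x | 1 - s ≤ cdf F x}
  have hne : A.Nonempty :=
    ((tendsto_cdf_atTop F).eventually (eventually_ge_nhds (by linarith))).exists
  have hbdd : BddBelow A := by
    obtain ⟨b, hb⟩ := ((tendsto_cdf_atBot F).eventually
      (eventually_lt_nhds (show (0 : ℝ) < 1 - s by linarith))).exists
    refine ⟨b, fun x hx => ?_⟩
    by_contra! hlt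
    have := monotone_cdf F hlt.le
    have hx' : 1 - s ≤ cdf F x := hx
    linarith
  set t := sInf A
  have hright : 1 - s ≤ cdf F t := by
    refine ge_of_tendsto (((cdf F).right_continuous t).mono Ioi_subset_Ici_self).tendsto ?_
    filter_upwards [self_mem_nhdsWithin] with x (hx : t < x)
    obtain ⟨y, hy, hyx⟩ := exists_lt_of_csInf_lt hne hx
    exact le_trans hy (monotone_cdf F hyx.le)
  have hleft : F.real (Iio t) ≤ 1 - s := by
    have : Tendsto (cdf F) (𝓝[<] t) (𝓝 (Function.leftLim (cdf F) t)) :=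
      (monotone_cdf F).tendsto_leftLim t
    have h2 : Function.leftLim (cdf F) t ≤ 1 - s := by
      refine le_of_tendsto this ?_
      filter_upwards [self_mem_nhdsWithin] with x (hx : x < t)
      by_contra! hlt
      exact absurd (csInf_le hbdd (show x ∈ A from hlt.le)) (not_le.2 hx)
    have h3 : F (Iio t) = ENNReal.ofReal (Function.leftLim (cdf F) t) := by
      conv_lhs => rw [← measure_cdf F]
      rw [(cdf F).measure_Iio (tendsto_cdf_atBot F), sub_zero]
    exact ENNReal.toReal_le_of_le_ofReal (by linarith)
      (h3.le.trans (ENNReal.ofReal_le_ofReal h2))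
  have hIic : F.real (Iic t) = F.real (Iio t) + F.real {t} := by
    rw [← Iio_union_right, measureReal_union (by simp) (measurableSet_singleton t)]
  have hIoi : F.real (Ioi t) = 1 - F.real (Iic t) := by
    rw [← compl_Iic, probReal_compl_eq_one_sub measurableSet_Iic]
  rw [cdf_eq_real] at hright
  obtain ⟨θ, hθ0, hθ1, hθ⟩ : ∃ θ : ℝ, 0 ≤ θ ∧ θ ≤ 1 ∧ θ * F.real {t} = s - F.real (Ioi t) := by
    rcases (measureReal_nonneg : 0 ≤ F.real {t}).eq_or_lt with h | h
    · exact ⟨0, le_rfl, zero_le_one, by linarith⟩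
    · refine ⟨(s - F.real (Ioi t)) / F.real {t}, div_nonneg (by linarith) h.le,
        (div_le_one h).2 (by linarith), div_mul_cancel₀ _ h.ne'⟩
  refine ⟨fun x => (Ioi t).indicator (fun _ => (1 : ℝ)) x + ({t} : Set ℝ).indicator (fun _ => θ) x,
    t, ⟨?_, ?_, ?_, ?_⟩, ?_⟩
  · intro x y hxy
    simp only [indicator_apply, mem_Ioi, mem_singleton_iff]
    split_ifs <;> first | linarith | grind
  · intro x
    simp only [indicator_apply, mem_Ioi, mem_singleton_iff, mem_Icc]
    split_ifs <;> constructor <;> linarith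
  · intro x hx
    simp [hx.le, hx.ne]
  · intro x hx
    simp [hx, hx.ne']
  · rw [integral_add ((integrable_const _).indicator measurableSet_Ioi)
      ((integrable_const _).indicator (measurableSet_singleton t)),
      integral_indicator_const _ measurableSet_Ioi,
      integral_indicator_const _ (measurableSet_singleton t)]
    simp only [smul_eq_mul]
    linarith

theorem IsThreshold.isDesign {g : ℝ → ℝ} {t : ℝ} (hg : IsThreshold g t) : IsDesign g :=
  ⟨hg.monotone.measurable, hg.mem_Icc⟩

theorem moment_zero : moment F p 0 = ∫ x, p x ∂F := by simp [moment]

/-- For `0 ≤ s ≤ 1`, `h s` has mean `s` and increases with `s`; for `0 < s < 1` it is a threshold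
function. At `s = 0` and `s = 1` a distribution of unbounded support has no finite threshold, and
the constants `0` and `1` are used. -/
structure IsThresholdFamily (F : Measure ℝ) (h : ℝ → ℝ → ℝ) : Prop where
  isDesign : ∀ s ∈ Icc (0 : ℝ) 1, IsDesign (h s)
  mono : ∀ s ∈ Icc (0 : ℝ) 1, ∀ r ∈ Icc (0 : ℝ) 1, s ≤ r → ∀ x, h s x ≤ h r x
  mean : ∀ s ∈ Icc (0 : ℝ) 1, moment F (h s) 0 = s
  zero : h 0 = 0
  one : h 1 = 1
  threshold : ∀ s ∈ Ioo (0 : ℝ) 1, ∃ t, IsThreshold (h s) t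

theorem exists_isThresholdFamily (hF : IsRunningDist F) : ∃ h, IsThresholdFamily F h := by
  have := hF.prob
  have H : ∀ s : ℝ, ∃ g : ℝ → ℝ, (s = 0 → g = 0) ∧ (s = 1 → g = 1) ∧
      (0 < s → s < 1 → (∃ t, IsThreshold g t) ∧ ∫ x, g x ∂F = s) := by
    intro s
    by_cases hs : 0 < s ∧ s < 1
    · obtain ⟨g, t, hg, hi⟩ := exists_isThreshold (F := F) this hs.1 hs.2
      exact ⟨g, by grind, by grind, fun _ _ => ⟨⟨t, hg⟩, hi⟩⟩
    · by_cases h0 : s = 0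
      · exact ⟨0, by grind, by grind, by grind⟩
      · exact ⟨1, by grind, by grind, by grind⟩
  choose h h0 h1 h2 using H
  have hd : ∀ s ∈ Icc (0 : ℝ) 1, IsDesign (h s) := by
    intro s hs
    rcases hs.1.eq_or_lt with e | l
    · rw [h0 s e.symm]
      exact ⟨measurable_const, fun x => by simp⟩
    rcases hs.2.eq_or_lt with e | u
    · rw [h1 s e]
      exact ⟨measurable_const, fun x => by simp⟩
    · obtain ⟨⟨t, ht⟩, -⟩ := h2 s l u
      exact ht.isDesign
  have hm : ∀ s ∈ Icc (0 : ℝ) 1, ∫ x, h s x ∂F = s := by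
    intro s hs
    rcases hs.1.eq_or_lt with e | l
    · rw [h0 s e.symm, ← e]
      simp
    rcases hs.2.eq_or_lt with e | u
    · rw [h1 s e, e]
      simp
    · exact (h2 s l u).2
  refine ⟨h, hd, ?_, fun s hs => moment_zero.trans (hm s hs), h0 0 rfl, h1 1 rfl,
    fun s hs => (h2 s hs.1 hs.2).1⟩
  intro s hs r hr hsr
  rcases hsr.eq_or_lt with rfl | hlt
  · exact fun x => le_rfl
  rcases hs.1.eq_or_lt with e | l
  · intro x
    rw [h0 s e.symm]
    exact ((hd r hr).mem_Icc x).1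
  rcases hr.2.eq_or_lt with e | u
  · intro x
    rw [h1 r e]
    exact ((hd s hs).mem_Icc x).2
  obtain ⟨⟨t, ht⟩, -⟩ := h2 s l (hlt.trans u)
  obtain ⟨⟨t', ht'⟩, -⟩ := h2 r (l.trans hlt) u
  -- Two threshold functions are pointwise comparable, and the means decide the direction.
  have hcomp : (∀ x, h s x ≤ h r x) ∨ ∀ x, h r x ≤ h s x := by
    rcases lt_trichotomy t t' with hl | rfl | hl
    · right
      intro x
      rcases lt_or_ge x t' with hx | hx
      · rw [ht'.left x hx]
        exact (ht.mem_Icc x).1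
      · rw [ht.right x (hl.trans_le hx)]
        exact (ht'.mem_Icc x).2
    · have key : ∀ g k : ℝ → ℝ, IsThreshold g t → IsThreshold k t → g t ≤ k t →
          ∀ x, g x ≤ k x := by
        intro g k hg hk hle x
        rcases lt_trichotomy x t with hx | rfl | hx
        · rw [hg.left x hx, hk.left x hx]
        · exact hle
        · rw [hg.right x hx, hk.right x hx]
      rcases le_total (h s t) (h r t) with hle | hle
      · exact Or.inl (key _ _ ht ht' hle)
      · exact Or.inr (key _ _ ht' ht hle)
    · left
      intro x
      rcases lt_or_ge x t with hx | hx
      · rw [ht.left x hx]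
        exact (ht'.mem_Icc x).1
      · rw [ht'.right x (hl.trans_le hx)]
        exact (ht.mem_Icc x).2
  refine hcomp.resolve_right fun hle => ?_
  have hi : ∀ s ∈ Icc (0 : ℝ) 1, Integrable (h s) F := fun s hs => by
    simpa using integrable_pow_mul hF (hd s hs) (k := 0) (by simp)
  have := integral_mono (hi r hr) (hi s hs) hle
  rw [hm s hs, hm r hr] at this
  exact absurd this (not_le.2 hlt)

/-- The moments of `h s` are continuous in `s`: truncating `x ^ k` at level `n` leaves an
`n`-Lipschitz function of `s`, and the truncations converge uniformly. -/
theorem IsThresholdFamily.continuousOn_moment {h : ℝ → ℝ → ℝ} (hh : IsThresholdFamily F h)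
    (hF : IsRunningDist F) {k : ℕ} (hk : k ≤ 2) :
    ContinuousOn (fun s => moment F (h s) k) (Icc 0 1) := by
  have := hF.prob
  set f : ℝ → ℝ := fun x => x ^ k
  have hfi : Integrable f F := hF.integrable_pow hk
  set fn : ℕ → ℝ → ℝ := fun n => {x | |f x| ≤ n}.indicator f
  have hms (n : ℕ) : MeasurableSet {x | |f x| ≤ n} :=
    measurableSet_le (by fun_prop) measurable_const
  have hfni (n : ℕ) : Integrable (fn n) F := hfi.indicator (hms n)
  have hbd (n : ℕ) (x : ℝ) : |fn n x| ≤ n := by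
    simp only [fn, indicator_apply, mem_ofPred_eq]
    split_ifs with hx
    · exact hx
    · simp
  have hdom (n : ℕ) (x : ℝ) : |f x - fn n x| ≤ |f x| := by
    simp only [fn, indicator_apply, mem_ofPred_eq]
    split_ifs with hx <;> simp
  have hmul {g : ℝ → ℝ} (hg : Integrable g F) {s : ℝ} (hs : s ∈ Icc (0 : ℝ) 1) :
      Integrable (fun x => g x * h s x) F :=
    hg.mul_bdd (hh.isDesign s hs).measurable.aestronglyMeasurable
      (ae_of_all _ fun x => by simpa using (hh.isDesign s hs).abs_le_one x)
  have hlim : Tendsto (fun n => ∫ x, |f x - fn n x| ∂F) atTop (𝓝 0) := by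
    have := tendsto_integral_of_dominated_convergence (μ := F) (F := fun n x => |f x - fn n x|)
      (f := fun _ => (0 : ℝ)) (fun x => |f x|)
      (fun n => (hfi.sub (hfni n)).abs.aestronglyMeasurable) hfi.abs
      (fun n => ae_of_all _ fun x => by simpa using hdom n x)
      (ae_of_all _ fun x => ?_)
    · simpa using this
    · refine tendsto_const_nhds.congr' ?_
      filter_upwards [eventually_ge_atTop ⌈|f x|⌉₊] with n hn
      have hx : |f x| ≤ n := (Nat.le_ceil _).trans (by exact_mod_cast hn)
      simp [fn, hx]
  have hunif : TendstoUniformlyOn (fun n s => ∫ x, fn n x * h s x ∂F)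
      (fun s => moment F (h s) k) atTop (Icc 0 1) := by
    rw [Metric.tendstoUniformlyOn_iff]
    intro ε hε
    filter_upwards [hlim.eventually (gt_mem_nhds hε)] with n hn s hs
    refine lt_of_le_of_lt ?_ hn
    rw [Real.dist_eq, moment, ← integral_sub (hmul hfi hs) (hmul (hfni n) hs)]
    refine (abs_integral_le_integral_abs).trans
      (integral_mono ((hmul hfi hs).sub (hmul (hfni n) hs)).abs (hfi.sub (hfni n)).abs fun x => ?_)
    change |f x * h s x - fn n x * h s x| ≤ |f x - fn n x|
    rw [← sub_mul, abs_mul]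
    exact mul_le_of_le_one_right (abs_nonneg _) ((hh.isDesign s hs).abs_le_one x)
  refine hunif.continuousOn (Frequently.of_forall fun n => ?_)
  have hlip : ∀ s ∈ Icc (0 : ℝ) 1, ∀ r ∈ Icc (0 : ℝ) 1, s ≤ r →
      |(∫ x, fn n x * h r x ∂F) - ∫ x, fn n x * h s x ∂F| ≤ n * (r - s) := by
    intro s hs r hr hsr
    have hi1 {s : ℝ} (hs : s ∈ Icc (0 : ℝ) 1) : Integrable (h s) F := by
      simpa using integrable_pow_mul hF (hh.isDesign s hs) (k := 0) (by simp)
    have e : (n : ℝ) * (r - s) = ∫ x, n * (h r x - h s x) ∂F := by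
      rw [integral_const_mul, integral_sub (hi1 hr) (hi1 hs), ← moment_zero (p := h r),
        ← moment_zero (p := h s),
        hh.mean r hr, hh.mean s hs]
    rw [e, ← integral_sub (hmul (hfni n) hr) (hmul (hfni n) hs)]
    refine (abs_integral_le_integral_abs).trans
      (integral_mono ((hmul (hfni n) hr).sub (hmul (hfni n) hs)).abs
        (((hi1 hr).sub (hi1 hs)).const_mul _) fun x => ?_)
    change |fn n x * h r x - fn n x * h s x| ≤ n * (h r x - h s x)
    have h3 := hh.mono s hs r hr hsr x
    rw [← mul_sub, abs_mul, abs_of_nonneg (sub_nonneg.2 h3)]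
    exact mul_le_mul_of_nonneg_right (hbd n x) (sub_nonneg.2 h3)
  refine (LipschitzOnWith.of_dist_le_mul (K := n) fun s hs r hr => ?_).continuousOn
  rw [Real.dist_eq, Real.dist_eq, NNReal.coe_natCast]
  rcases le_total s r with hsr | hsr
  · rw [abs_sub_comm, abs_sub_comm s, abs_of_nonneg (sub_nonneg.2 hsr)]
    exact hlip s hs r hr hsr
  · rw [abs_of_nonneg (sub_nonneg.2 hsr)]
    exact hlip r hr s hs hsr

/-! ### Comparisons by counting sign changes -/

theorem moment_one_nonneg {g : ℝ → ℝ}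
    (hg : ∀ k ≤ 2, Integrable (fun x => x ^ k * g x) F) (h0 : moment F g 0 = 0) {t : ℝ}
    (ht : ∀ x, 0 ≤ (x - t) * g x) : 0 ≤ moment F g 1 := by
  have h : ∫ x, (x - t) * g x ∂F = moment F g 1 - t * moment F g 0 := by
    rw [moment, moment, ← integral_const_mul,
      ← integral_sub (hg 1 (by simp)) ((hg 0 (by simp)).const_mul t)]
    exact integral_congr_ae (ae_of_all _ fun x => by ring)
  have : 0 ≤ ∫ x, (x - t) * g x ∂F := integral_nonneg ht
  rw [h, h0] at this
  linarith

theorem moment_two_nonneg {g : ℝ → ℝ}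
    (hg : ∀ k ≤ 2, Integrable (fun x => x ^ k * g x) F) (h0 : moment F g 0 = 0)
    (h1 : moment F g 1 = 0) {t t' : ℝ} (ht : ∀ x, 0 ≤ (x - t) * (x - t') * g x) :
    0 ≤ moment F g 2 := by
  have h : ∫ x, (x - t) * (x - t') * g x ∂F =
      moment F g 2 - ((t + t') * moment F g 1 - t * t' * moment F g 0) := by
    rw [moment, moment, moment, ← integral_const_mul, ← integral_const_mul,
      ← integral_sub ((hg 1 (by simp)).const_mul _) ((hg 0 (by simp)).const_mul _),
      ← integral_sub (hg 2 le_rfl)]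
    · exact integral_congr_ae (ae_of_all _ fun x => by ring)
    · exact ((hg 1 (by simp)).const_mul _).sub ((hg 0 (by simp)).const_mul _)
  have : 0 ≤ ∫ x, (x - t) * (x - t') * g x ∂F := integral_nonneg ht
  rw [h, h0, h1] at this
  linarith

/-- A function with vanishing moments of order `0` and `1` and a single sign change vanishes
almost everywhere off the point of change, so its second moment vanishes as well. -/
theorem moment_two_eq_zero {g : ℝ → ℝ}
    (hg : ∀ k ≤ 2, Integrable (fun x => x ^ k * g x) F) (h0 : moment F g 0 = 0)
    (h1 : moment F g 1 = 0) {t : ℝ} (ht : ∀ x, 0 ≤ (x - t) * g x) :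
    moment F g 2 = 0 := by
  have hi : Integrable (fun x => (x - t) * g x) F :=
    ((hg 1 (by simp)).sub ((hg 0 (by simp)).const_mul t)).congr
      (ae_of_all _ fun x => by simp; ring)
  have h : ∫ x, (x - t) * g x ∂F = moment F g 1 - t * moment F g 0 := by
    rw [moment, moment, ← integral_const_mul,
      ← integral_sub (hg 1 (by simp)) ((hg 0 (by simp)).const_mul t)]
    exact integral_congr_ae (ae_of_all _ fun x => by ring)
  rw [h0, h1, mul_zero, sub_zero, integral_eq_zero_iff_of_nonneg ht hi] at h
  have h' : ∫ x, (x + t) * ((x - t) * g x) ∂F = 0 :=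
    integral_eq_zero_of_ae (h.mono fun x hx => by
      have : (x - t) * g x = 0 := hx
      simp [this])
  have e : ∫ x, (x + t) * ((x - t) * g x) ∂F = moment F g 2 - t ^ 2 * moment F g 0 := by
    rw [moment, moment, ← integral_const_mul,
      ← integral_sub (hg 2 le_rfl) ((hg 0 (by simp)).const_mul _)]
    exact integral_congr_ae (ae_of_all _ fun x => by ring)
  rw [h', h0] at e
  linarith

theorem IsDesign.integrable_sub (hF : IsRunningDist F) (hp : IsDesign p) (hq : IsDesign q) :
    ∀ k ≤ 2, Integrable (fun x => x ^ k * (p x - q x)) F := fun _ hk =>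
  ((integrable_pow_mul hF hp hk).sub (integrable_pow_mul hF hq hk)).congr
    (ae_of_all _ fun _ => (mul_sub _ _ _).symm)

theorem moment_sub (hF : IsRunningDist F) (hp : IsDesign p) (hq : IsDesign q) {k : ℕ}
    (hk : k ≤ 2) : moment F (fun x => p x - q x) k = moment F p k - moment F q k := by
  rw [moment, moment, moment,
    ← integral_sub (integrable_pow_mul hF hp hk) (integrable_pow_mul hF hq hk)]
  exact integral_congr_ae (ae_of_all _ fun _ => mul_sub _ _ _)

/-- Among the monotone designs with given moments of order `0` and `1`, a two-level design with
lower level `0` has the least second moment: the difference to it has the signs `+, -, +`. -/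
theorem moment_two_le_of_left_eq_zero (hF : IsRunningDist F) (hp : IsDesign p) (hpm : Monotone p)
    (hq : IsDesign q) {t u : ℝ} (hl : ∀ x, x < t → q x = 0) (hr : ∀ x, t < x → q x = u)
    (h0 : moment F p 0 = moment F q 0) (h1 : moment F p 1 = moment F q 1) :
    moment F q 2 ≤ moment F p 2 := by
  by_cases hc : ∃ x, t < x ∧ u < p x
  · set A := {x | t < x ∧ u < p x}
    have hb : BddBelow A := ⟨t, fun x hx => hx.1.le⟩
    have htt : t ≤ sInf A := le_csInf hc fun x hx => hx.1.le
    have := moment_two_nonneg (IsDesign.integrable_sub hF hp hq)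
      (by rw [moment_sub hF hp hq (by simp), h0, sub_self])
      (by rw [moment_sub hF hp hq (by simp), h1, sub_self]) (t := t) (t' := sInf A) ?_
    · rw [moment_sub hF hp hq le_rfl] at this
      linarith
    · intro x
      rcases lt_trichotomy x t with hx | rfl | hx
      · rw [hl x hx, sub_zero]
        exact mul_nonneg (mul_nonneg_of_nonpos_of_nonpos (by linarith) (by linarith))
          (hp.mem_Icc x).1
      · simp
      · rw [hr x hx, mul_assoc]
        refine mul_nonneg (by linarith) ?_
        rcases lt_trichotomy x (sInf A) with hx' | hx' | hx'
        · have : p x ≤ u := by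
            by_contra! hlt
            exact absurd (csInf_le hb ⟨hx, hlt⟩) (not_le.2 hx')
          exact mul_nonneg_of_nonpos_of_nonpos (by linarith) (by linarith)
        · rw [hx']
          simp
        · obtain ⟨y, hy, hyx⟩ := exists_lt_of_csInf_lt hc hx'
          exact mul_nonneg (by linarith) (by linarith [hpm hyx.le, hy.2])
  · push Not at hc
    have := moment_two_eq_zero (IsDesign.integrable_sub hF hq hp)
      (by rw [moment_sub hF hq hp (by simp), h0, sub_self])
      (by rw [moment_sub hF hq hp (by simp), h1, sub_self]) (t := t) ?_
    · rw [moment_sub hF hq hp le_rfl] at this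
      linarith
    · intro x
      rcases lt_trichotomy x t with hx | rfl | hx
      · rw [hl x hx]
        exact mul_nonneg_of_nonpos_of_nonpos (by linarith) (by linarith [(hp.mem_Icc x).1])
      · simp
      · rw [hr x hx]
        exact mul_nonneg (by linarith) (by linarith [hc x hx])

/-- Among the monotone designs with given moments of order `0` and `1`, a two-level design with
upper level `1` has the greatest second moment: the difference to it has the signs `-, +, -`. -/
theorem moment_two_le_of_right_eq_one (hF : IsRunningDist F) (hp : IsDesign p) (hpm : Monotone p)
    (hq : IsDesign q) {t l : ℝ} (hl : ∀ x, x < t → q x = l) (hr : ∀ x, t < x → q x = 1)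
    (h0 : moment F p 0 = moment F q 0) (h1 : moment F p 1 = moment F q 1) :
    moment F p 2 ≤ moment F q 2 := by
  by_cases hc : ∃ x, x < t ∧ p x < l
  · set A := {x | x < t ∧ p x < l}
    have hb : BddAbove A := ⟨t, fun x hx => hx.1.le⟩
    have htt : sSup A ≤ t := csSup_le hc fun x hx => hx.1.le
    have := moment_two_nonneg (IsDesign.integrable_sub hF hq hp)
      (by rw [moment_sub hF hq hp (by simp), h0, sub_self])
      (by rw [moment_sub hF hq hp (by simp), h1, sub_self]) (t := t) (t' := sSup A) ?_
    · rw [moment_sub hF hq hp le_rfl] at this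
      linarith
    · intro x
      rcases lt_trichotomy x t with hx | rfl | hx
      · rw [hl x hx, mul_assoc]
        refine mul_nonneg_of_nonpos_of_nonpos (by linarith) ?_
        rcases lt_trichotomy x (sSup A) with hx' | hx' | hx'
        · obtain ⟨y, hy, hxy⟩ := exists_lt_of_lt_csSup hc hx'
          exact mul_nonpos_of_nonpos_of_nonneg (by linarith) (by linarith [hpm hxy.le, hy.2])
        · rw [hx']
          simp
        · have : l ≤ p x := by
            by_contra! hlt
            exact absurd (le_csSup hb ⟨hx, hlt⟩) (not_le.2 hx')
          exact mul_nonpos_of_nonneg_of_nonpos (by linarith) (by linarith)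
      · simp
      · rw [hr x hx]
        exact mul_nonneg (mul_nonneg (by linarith) (by linarith))
          (by linarith [(hp.mem_Icc x).2])
  · push Not at hc
    have := moment_two_eq_zero (IsDesign.integrable_sub hF hq hp)
      (by rw [moment_sub hF hq hp (by simp), h0, sub_self])
      (by rw [moment_sub hF hq hp (by simp), h1, sub_self]) (t := t) ?_
    · rw [moment_sub hF hq hp le_rfl] at this
      linarith
    · intro x
      rcases lt_trichotomy x t with hx | rfl | hx
      · rw [hl x hx]
        exact mul_nonneg_of_nonpos_of_nonpos (by linarith) (by linarith [hc x hx])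
      · simp
      · rw [hr x hx]
        exact mul_nonneg (by linarith) (by linarith [(hp.mem_Icc x).2])

/-- Threshold functions maximize the first moment among the designs of the same mean. -/
theorem IsThresholdFamily.moment_one_le (hh : IsThresholdFamily F h) (hF : IsRunningDist F)
    (hp : IsDesign p) {s : ℝ} (hs : s ∈ Ioo (0 : ℝ) 1) (h0 : moment F p 0 = s) :
    moment F p 1 ≤ moment F (h s) 1 := by
  have hs' := Ioo_subset_Icc_self hs
  have hd := hh.isDesign s hs'
  obtain ⟨t, ht⟩ := hh.threshold s hs
  have := moment_one_nonneg (IsDesign.integrable_sub hF hd hp)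
    (by rw [moment_sub hF hd hp (by simp), h0, hh.mean s hs', sub_self]) (t := t) ?_
  · rw [moment_sub hF hd hp (by simp)] at this
    linarith
  · intro x
    rcases lt_trichotomy x t with hx | rfl | hx
    · rw [ht.left x hx]
      exact mul_nonneg_of_nonpos_of_nonpos (by linarith) (by linarith [(hp.mem_Icc x).1])
    · simp
    · rw [ht.right x hx]
      exact mul_nonneg (by linarith) (by linarith [(hp.mem_Icc x).2])

theorem moment_combination (hF : IsRunningDist F) (hp : IsDesign p) (hq : IsDesign q)
    (a b c : ℝ) {k : ℕ} (hk : k ≤ 2) :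
    Integrable (fun x => x ^ k * (a * p x + b * q x + c)) F ∧
    moment F (fun x => a * p x + b * q x + c) k =
      a * moment F p k + b * moment F q k + c * ∫ x, x ^ k ∂F := by
  have h1 := (integrable_pow_mul hF hp hk).const_mul a
  have h2 := (integrable_pow_mul hF hq hk).const_mul b
  have h3 := (hF.integrable_pow hk).const_mul c
  have e : (fun x => x ^ k * (a * p x + b * q x + c)) =
      fun x => a * (x ^ k * p x) + b * (x ^ k * q x) + c * x ^ k := by
    funext x
    ring
  have h12 : Integrable (fun x => a * (x ^ k * p x) + b * (x ^ k * q x)) F := h1.add h2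
  refine ⟨e ▸ h12.add h3, ?_⟩
  rw [moment, e, integral_add h12 h3, integral_add h1 h2, integral_const_mul, integral_const_mul,
    integral_const_mul]
  rfl

theorem IsRunningDist.integral_pow_zero (hF : IsRunningDist F) : ∫ x, x ^ 0 ∂F = 1 := by
  have := hF.prob
  simp

theorem IsRunningDist.integral_pow_one (hF : IsRunningDist F) : ∫ x, x ^ 1 ∂F = 0 := by
  simpa using hF.mean_zero

/-- The first moment `G s` of the threshold function of mean `s` has `G s / s` nonincreasing. -/
theorem IsThresholdFamily.mul_moment_one_le (hh : IsThresholdFamily F h) (hF : IsRunningDist F)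
    {s r : ℝ} (hs : s ∈ Ioo (0 : ℝ) 1) (hr : r ∈ Ioo (0 : ℝ) 1) (hsr : s ≤ r) :
    s * moment F (h r) 1 ≤ r * moment F (h s) 1 := by
  have hs' := Ioo_subset_Icc_self hs
  have hr' := Ioo_subset_Icc_self hr
  obtain ⟨t, ht⟩ := hh.threshold s hs
  have hc (k : ℕ) (hk : k ≤ 2) :=
    moment_combination hF (hh.isDesign s hs') (hh.isDesign r hr') r (-s) 0 hk
  have := moment_one_nonneg (fun k hk => (hc k hk).1)
    (by rw [(hc 0 (by simp)).2, hh.mean s hs', hh.mean r hr']; ring) (t := t) ?_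
  · rw [(hc 1 (by simp)).2] at this
    linarith
  · intro x
    have h1 := (hh.isDesign r hr').mem_Icc x
    rcases lt_trichotomy x t with hx | rfl | hx
    · rw [ht.left x hx]
      exact mul_nonneg_of_nonpos_of_nonpos (by linarith) (by nlinarith [h1.1, hs.1])
    · simp
    · rw [ht.right x hx]
      exact mul_nonneg (by linarith) (by nlinarith [h1.2, hs.1])

/-- The first moment `G s` of the threshold function of mean `s` has `G s / (1 - s)`
nondecreasing. -/
theorem IsThresholdFamily.one_sub_mul_moment_one_le (hh : IsThresholdFamily F h)
    (hF : IsRunningDist F) {s r : ℝ} (hs : s ∈ Ioo (0 : ℝ) 1) (hr : r ∈ Ioo (0 : ℝ) 1)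
    (hsr : s ≤ r) : (1 - r) * moment F (h s) 1 ≤ (1 - s) * moment F (h r) 1 := by
  have hs' := Ioo_subset_Icc_self hs
  have hr' := Ioo_subset_Icc_self hr
  obtain ⟨t, ht⟩ := hh.threshold r hr
  have hc (k : ℕ) (hk : k ≤ 2) :=
    moment_combination hF (hh.isDesign s hs') (hh.isDesign r hr') (-(1 - r)) (1 - s) (s - r) hk
  have := moment_one_nonneg (fun k hk => (hc k hk).1)
    (by rw [(hc 0 (by simp)).2, hh.mean s hs', hh.mean r hr',
      hF.integral_pow_zero]; ring) (t := t) ?_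
  · rw [(hc 1 (by simp)).2, hF.integral_pow_one] at this
    linarith
  · intro x
    have h1 := (hh.isDesign s hs').mem_Icc x
    rcases lt_trichotomy x t with hx | rfl | hx
    · rw [ht.left x hx]
      exact mul_nonneg_of_nonpos_of_nonpos (by linarith) (by nlinarith [h1.1, hr.2])
    · simp
    · rw [ht.right x hx]
      exact mul_nonneg (by linarith) (by nlinarith [h1.2, hr.2])

/-! ### Two-level designs with prescribed moments -/

/-- The function with two levels that jumps where `h s` does and has moments `c` and `m` of order
`0` and `1` (provided that the first moment of `h s` is not zero). -/
noncomputable def twoLevel (F : Measure ℝ) (h : ℝ → ℝ → ℝ) (c m s : ℝ) : ℝ → ℝ :=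
  fun x => c + m / moment F (h s) 1 * (h s x - s)

theorem IsThresholdFamily.moment_twoLevel (hh : IsThresholdFamily F h) (hF : IsRunningDist F)
    {c m s : ℝ} (hs : s ∈ Icc (0 : ℝ) 1) {k : ℕ} (hk : k ≤ 2) :
    moment F (twoLevel F h c m s) k = c * ∫ x, x ^ k ∂F +
      m / moment F (h s) 1 * (moment F (h s) k - s * ∫ x, x ^ k ∂F) := by
  have hd := hh.isDesign s hs
  have e : twoLevel F h c m s = fun x =>
      m / moment F (h s) 1 * h s x + 0 * h s x + (c - m / moment F (h s) 1 * s) := by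
    funext x
    rw [twoLevel]
    ring
  rw [e, (moment_combination hF hd hd _ _ _ hk).2]
  ring

theorem IsThresholdFamily.moment_twoLevel_zero (hh : IsThresholdFamily F h)
    (hF : IsRunningDist F) {c m s : ℝ} (hs : s ∈ Icc (0 : ℝ) 1) :
    moment F (twoLevel F h c m s) 0 = c := by
  rw [hh.moment_twoLevel hF hs (by simp), hF.integral_pow_zero, hh.mean s hs]
  ring

theorem IsThresholdFamily.moment_twoLevel_one (hh : IsThresholdFamily F h)
    (hF : IsRunningDist F) {c m s : ℝ} (hs : s ∈ Icc (0 : ℝ) 1) (hG : 0 < moment F (h s) 1) :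
    moment F (twoLevel F h c m s) 1 = m := by
  rw [hh.moment_twoLevel hF hs (by simp), hF.integral_pow_one]
  field_simp
  ring

/-- The parameters `s` for which `twoLevel F h c m s` has levels in `[0, 1]` contain a compact
interval `[a, b]` around `c`; the upper level is `1` at `a`, the lower one is `0` at `b`. -/
theorem IsThresholdFamily.exists_parameter_interval (hh : IsThresholdFamily F h)
    (hF : IsRunningDist F) {c m : ℝ} (hc : c ∈ Ioo (0 : ℝ) 1) (hm : 0 < m)
    (hmG : m ≤ moment F (h c) 1) :
    ∃ a b, 0 < a ∧ a ≤ b ∧ b < 1 ∧ (1 - c) * moment F (h a) 1 = m * (1 - a) ∧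
      c * moment F (h b) 1 = m * b ∧
      ∀ s ∈ Icc a b, 0 < moment F (h s) 1 ∧ m * s ≤ c * moment F (h s) 1 ∧
        m * (1 - s) ≤ (1 - c) * moment F (h s) 1 := by
  obtain ⟨hc0, hc1⟩ := hc
  set G : ℝ → ℝ := fun s => moment F (h s) 1
  have hGc : ContinuousOn G (Icc 0 1) := hh.continuousOn_moment hF (by simp)
  have hG0 : G 0 = 0 := by simp [G, hh.zero, moment]
  have hG1 : G 1 = 0 := by simpa [G, hh.one, moment] using hF.mean_zero
  obtain ⟨b, hb, hbe⟩ : (0 : ℝ) ∈ (fun s => c * G s - m * s) '' Icc c 1 := by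
    refine intermediate_value_Icc' hc1.le ?_ ⟨?_, ?_⟩
    · exact ((hGc.mono (Icc_subset_Icc_left hc0.le)).const_mul c).sub (by fun_prop)
    · simp only [hG1]
      linarith
    · change 0 ≤ c * moment F (h c) 1 - m * c
      nlinarith
  obtain ⟨a, ha, hae⟩ : (0 : ℝ) ∈ (fun s => (1 - c) * G s - m * (1 - s)) '' Icc 0 c := by
    refine intermediate_value_Icc hc0.le ?_ ⟨?_, ?_⟩
    · exact ((hGc.mono (Icc_subset_Icc_right hc1.le)).const_mul _).sub (by fun_prop)
    · simp only [hG0]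
      linarith
    · change 0 ≤ (1 - c) * moment F (h c) 1 - m * (1 - c)
      nlinarith
  simp only at hbe hae
  have ha0 : 0 < a := ha.1.lt_of_ne fun e => by
    rw [← e, hG0] at hae
    linarith
  have hb1 : b < 1 := hb.2.lt_of_ne fun e => by
    rw [e, hG1] at hbe
    linarith
  have hab := ha.2.trans hb.1
  refine ⟨a, b, ha0, hab, hb1, by linarith, by linarith, fun s hs => ?_⟩
  have hs0 : 0 < s := ha0.trans_le hs.1
  have hs1 : s < 1 := hs.2.trans_lt hb1
  have hb0 : 0 < b := ha0.trans_le hab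
  have e1 : s * G b ≤ b * G s :=
    hh.mul_moment_one_le hF ⟨hs0, hs1⟩ ⟨hb0, hb1⟩ hs.2
  have e2 : (1 - s) * G a ≤ (1 - a) * G s :=
    hh.one_sub_mul_moment_one_le hF ⟨ha0, hab.trans_lt hb1⟩ ⟨hs0, hs1⟩ hs.1
  have e3 : m * s ≤ c * G s := by
    refine le_of_mul_le_mul_left ?_ hb0
    calc b * (m * s) = s * (c * G b) := by
          rw [show c * G b = m * b by linarith]
          ring
      _ = c * (s * G b) := by ring
      _ ≤ c * (b * G s) := mul_le_mul_of_nonneg_left e1 hc0.le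
      _ = b * (c * G s) := by ring
  have e4 : m * (1 - s) ≤ (1 - c) * G s := by
    refine le_of_mul_le_mul_left ?_ (show 0 < 1 - a by linarith)
    calc (1 - a) * (m * (1 - s)) = (1 - s) * ((1 - c) * G a) := by
          rw [show (1 - c) * G a = m * (1 - a) by linarith]
          ring
      _ = (1 - c) * ((1 - s) * G a) := by ring
      _ ≤ (1 - c) * ((1 - a) * G s) := mul_le_mul_of_nonneg_left e2 (by linarith)
      _ = (1 - a) * ((1 - c) * G s) := by ring
  exact ⟨pos_of_mul_pos_right ((mul_pos hm hs0).trans_le e3) hc0.le, e3, e4⟩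

/-! ### Extremal cases and optimality -/

theorem twoLevel_mem_Icc_zero_one {c m s : ℝ} (hm : 0 ≤ m) (hG : 0 < moment F (h s) 1)
    (h1 : m * s ≤ c * moment F (h s) 1) (h2 : m * (1 - s) ≤ (1 - c) * moment F (h s) 1)
    {x : ℝ} (hx : h s x ∈ Icc (0 : ℝ) 1) : twoLevel F h c m s x ∈ Icc (0 : ℝ) 1 := by
  have hd : 0 ≤ m / moment F (h s) 1 := div_nonneg hm hG.le
  have h1' : m / moment F (h s) 1 * s ≤ c := by
    rw [div_mul_eq_mul_div]
    exact (div_le_iff₀ hG).2 h1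
  have h2' : m / moment F (h s) 1 * (1 - s) ≤ 1 - c := by
    rw [div_mul_eq_mul_div]
    exact (div_le_iff₀ hG).2 h2
  have h3 := mul_nonneg hd hx.1
  have h4 := mul_nonneg hd (sub_nonneg.2 hx.2)
  rw [twoLevel]
  constructor <;> nlinarith

/-- A monotone design that is uncorrelated with the running variable is constant almost
everywhere, so all its moments are those of the constant. -/
theorem moment_of_moment_one_eq_zero (hF : IsRunningDist F) (hp : IsDesign p) (hpm : Monotone p)
    (h1 : moment F p 1 = 0) (k : ℕ) : moment F p k = moment F p 0 * ∫ x, x ^ k ∂F := by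
  have hpi := integrable_pow_mul hF hp (k := 1) (by simp)
  have hxi := (hF.integrable_pow (k := 1) (by simp)).const_mul (p 0)
  have hz : ∫ x, (x ^ 1 * p x - p 0 * x ^ 1) ∂F = 0 := by
    rw [integral_sub hpi hxi, integral_const_mul, hF.integral_pow_one, mul_zero, sub_zero]
    exact h1
  have hnn : ∀ x, 0 ≤ x ^ 1 * p x - p 0 * x ^ 1 := fun x => by
    have : x ^ 1 * p x - p 0 * x ^ 1 = x * (p x - p 0) := by ring
    rw [this]
    rcases le_total 0 x with hx | hx
    · exact mul_nonneg hx (sub_nonneg.2 (hpm hx))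
    · exact mul_nonneg_of_nonpos_of_nonpos hx (sub_nonpos.2 (hpm hx))
  rw [integral_eq_zero_iff_of_nonneg hnn (hpi.sub hxi)] at hz
  have hae : ∀ᵐ x ∂F, p x = p 0 := hz.mono fun x hx => by
    have hx' : x * (p x - p 0) = 0 := by
      have : x ^ 1 * p x - p 0 * x ^ 1 = 0 := hx
      linarith
    rcases mul_eq_zero.1 hx' with rfl | h
    · rfl
    · linarith
  have key (n : ℕ) : moment F p n = p 0 * ∫ x, x ^ n ∂F := by
    rw [moment, ← integral_const_mul]
    exact integral_congr_ae (hae.mono fun x hx => by simp [hx, mul_comm])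
  rw [key k, key 0, hF.integral_pow_zero, mul_one]

theorem isDesign_const {c : ℝ} (hc : c ∈ Icc (0 : ℝ) 1) : IsDesign fun _ => c :=
  ⟨measurable_const, fun _ => hc⟩

theorem moment_const (c : ℝ) (k : ℕ) : moment F (fun _ => c) k = c * ∫ x, x ^ k ∂F := by
  rw [moment, integral_mul_const, mul_comm]

theorem momentZ_zero_one_eq_iff (hF : IsRunningDist F) (hp : IsDesign p) {zt xzt : ℝ} :
    momentZ F p 0 = zt ∧ momentZ F p 1 = xzt ↔
      moment F p 0 = (1 + zt) / 2 ∧ moment F p 1 = xzt / 2 := by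
  rw [momentZ_eq hF hp (by simp), momentZ_eq hF hp (by simp), hF.integral_pow_zero,
    hF.integral_pow_one]
  constructor <;> rintro ⟨h0, h1⟩ <;> constructor <;> linarith

theorem IsThresholdFamily.xzMax_le (hh : IsThresholdFamily F h) (hF : IsRunningDist F) {zt : ℝ}
    (h1 : -1 < zt) (h2 : zt < 1) : xzMax F zt ≤ 2 * moment F (h ((1 + zt) / 2)) 1 := by
  have hc : (1 + zt) / 2 ∈ Ioo (0 : ℝ) 1 := ⟨by linarith, by linarith⟩
  refine csSup_le ?_ ?_
  · have hd := isDesign_const (Ioo_subset_Icc_self hc)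
    refine ⟨_, _, hd, ((momentZ_zero_one_eq_iff hF hd (xzt := 0)).2 ⟨?_, ?_⟩).1, rfl⟩
    · rw [moment_const, hF.integral_pow_zero, mul_one]
    · rw [moment_const, hF.integral_pow_one, mul_zero, zero_div]
  · rintro y ⟨p, hp, h0, rfl⟩
    obtain ⟨e0, e1⟩ := (momentZ_zero_one_eq_iff hF hp).1 ⟨h0, rfl⟩
    have := hh.moment_one_le hF hp hc e0
    linarith

end TieBreaker

open TieBreaker in
theorem theorem2 (F : Measure ℝ) (hF : TieBreaker.IsRunningDist F)
    (hF3 : Integrable (fun x : ℝ => |x| ^ 3) F)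
    (σ : ℝ) (hσ : 0 < σ)
    (Ψ : Matrix (Fin 4) (Fin 4) ℝ → EReal)
    (hΨ : ContinuousOn Ψ (TieBreaker.inputFeasibleMatrices F σ))
    (zt xzt : ℝ) (hJ : (zt, xzt) ∈ TieBreaker.feasibleInputs F) :
    ∃ p : ℝ → ℝ, TieBreaker.IsOptimal F σ Ψ TieBreaker.monotoneDesigns zt xzt p ∧
      ∃ l u t : ℝ, 0 ≤ l ∧ l ≤ u ∧ u ≤ 1 ∧
        (∀ x, x < t → p x = l) ∧ (∀ x, t < x → p x = u) := by
  obtain ⟨hz1, hz2, hx0, hx1⟩ := hJ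
  simp only at hz1 hz2 hx0 hx1
  set c := (1 + zt) / 2 with hcdef
  have hc : c ∈ Ioo (0 : ℝ) 1 := ⟨by linarith, by linarith⟩
  have hc' := Ioo_subset_Icc_self hc
  have hinfo {p : ℝ → ℝ} (hp : IsFeasible F monotoneDesigns zt xzt p) :
      infoMatrix F σ p = momentMatrix F σ zt xzt (momentZ F p 2) := by
    rw [infoMatrix_eq hF hp.1.1, hp.2.1, hp.2.2]
  rcases hx0.eq_or_lt with rfl | hpos
  · -- All feasible monotone designs are constant almost everywhere.
    have hd := isDesign_const hc'
    have hfeas : IsFeasible F monotoneDesigns zt 0 (fun _ => c) := by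
      refine ⟨⟨hd, monotone_const⟩, (momentZ_zero_one_eq_iff hF hd).2 ⟨?_, ?_⟩⟩
      · rw [moment_const, hF.integral_pow_zero, mul_one]
      · rw [moment_const, hF.integral_pow_one, mul_zero, zero_div]
    refine ⟨fun _ => c, ⟨hfeas, fun q hq => le_of_eq ?_⟩, c, c, 0, hc'.1, le_rfl, hc'.2,
      fun _ _ => rfl, fun _ _ => rfl⟩
    obtain ⟨e0, e1⟩ := (momentZ_zero_one_eq_iff hF hq.1.1).1 hq.2
    rw [hinfo hq, hinfo hfeas, momentZ_eq hF hq.1.1 le_rfl, momentZ_eq hF hd le_rfl,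
      moment_const, moment_of_moment_one_eq_zero hF hq.1.1 hq.1.2 (by simpa using e1) 2, e0]
  obtain ⟨h, hh⟩ := exists_isThresholdFamily hF
  have hmpos : 0 < xzt / 2 := by linarith
  set m := xzt / 2 with hmdef
  have hmG : m ≤ moment F (h c) 1 := by
    have := hh.xzMax_le hF hz1 hz2
    linarith
  obtain ⟨a, b, ha0, hab, hb1, hae, hbe, hint⟩ := hh.exists_parameter_interval hF hc hmpos hmG
  have hIoo : ∀ s ∈ Icc a b, s ∈ Ioo (0 : ℝ) 1 := fun s hs =>
    ⟨ha0.trans_le hs.1, hs.2.trans_lt hb1⟩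
  have hIcc : ∀ s ∈ Icc a b, s ∈ Icc (0 : ℝ) 1 := fun s hs => Ioo_subset_Icc_self (hIoo s hs)
  set P : ℝ → ℝ → ℝ := twoLevel F h c m
  have hmono : ∀ s ∈ Icc a b, Monotone (P s) := by
    intro s hs x y hxy
    obtain ⟨t, ht⟩ := hh.threshold s (hIoo s hs)
    have := mul_le_mul_of_nonneg_left (ht.monotone hxy)
      (div_nonneg hmpos.le (hint s hs).1.le)
    simp only [P, twoLevel]
    linarith
  have hrange : ∀ s ∈ Icc a b, ∀ {x : ℝ}, h s x ∈ Icc (0 : ℝ) 1 → P s x ∈ Icc (0 : ℝ) 1 :=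
    fun s hs _ hx =>
      twoLevel_mem_Icc_zero_one hmpos.le (hint s hs).1 (hint s hs).2.1 (hint s hs).2.2 hx
  have hdes : ∀ s ∈ Icc a b, IsDesign (P s) := fun s hs =>
    ⟨(hmono s hs).measurable, fun x => hrange s hs ((hh.isDesign s (hIcc s hs)).mem_Icc x)⟩
  have hP0 : ∀ s ∈ Icc a b, moment F (P s) 0 = c := fun s hs =>
    hh.moment_twoLevel_zero hF (hIcc s hs)
  have hP1 : ∀ s ∈ Icc a b, moment F (P s) 1 = m := fun s hs =>
    hh.moment_twoLevel_one hF (hIcc s hs) (hint s hs).1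
  have hfeas : ∀ s ∈ Icc a b, IsFeasible F monotoneDesigns zt xzt (P s) := fun s hs =>
    ⟨⟨hdes s hs, hmono s hs⟩,
      (momentZ_zero_one_eq_iff hF (hdes s hs)).2 ⟨hP0 s hs, hP1 s hs⟩⟩
  have hcont : ContinuousOn (fun s => momentZ F (P s) 2) (Icc a b) := by
    have hG (k : ℕ) (hk : k ≤ 2) : ContinuousOn (fun s => moment F (h s) k) (Icc a b) :=
      (hh.continuousOn_moment hF hk).mono hIcc
    have : ContinuousOn (fun s => 2 * (c * ∫ x, x ^ 2 ∂F +
        m / moment F (h s) 1 * (moment F (h s) 2 - s * ∫ x, x ^ 2 ∂F)) - ∫ x, x ^ 2 ∂F)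
        (Icc a b) := by
      have hq := (continuousOn_const (c := m)).div (hG 1 (by simp))
        fun s hs => (hint s hs).1.ne'
      have hr := (hG 2 le_rfl).sub
        ((continuousOn_id (s := Icc a b)).mul (continuousOn_const (c := ∫ x, x ^ 2 ∂F)))
      exact ((continuousOn_const.add (hq.mul hr)).const_mul 2).sub continuousOn_const
    refine this.congr fun s hs => ?_
    simp only
    rw [momentZ_eq hF (hdes s hs) le_rfl, hh.moment_twoLevel hF (hIcc s hs) le_rfl]
  have hΨc : ContinuousOn (fun s => Ψ (infoMatrix F σ (P s))) (Icc a b) := by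
    refine hΨ.comp (t := inputFeasibleMatrices F σ) (f := fun s => infoMatrix F σ (P s)) ?_ ?_
    · exact ((continuous_momentMatrix σ zt xzt).comp_continuousOn hcont).congr
        fun s hs => hinfo (hfeas s hs)
    · intro s hs
      refine ⟨P s, hdes s hs, ?_, rfl⟩
      rw [(hfeas s hs).2.1, (hfeas s hs).2.2]
      exact ⟨hz1, hz2, hx0, hx1⟩
  obtain ⟨s, hs, hmax⟩ := isCompact_Icc.exists_isMaxOn (nonempty_Icc.2 hab) hΨc
  refine ⟨P s, ⟨hfeas s hs, fun q hq => ?_⟩, ?_⟩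
  · -- Some `P r` has the same information matrix as `q`.
    obtain ⟨e0, e1⟩ := (momentZ_zero_one_eq_iff hF hq.1.1).1 hq.2
    have haI : a ∈ Icc a b := left_mem_Icc.2 hab
    have hbI : b ∈ Icc a b := right_mem_Icc.2 hab
    have hlow : moment F (P b) 2 ≤ moment F q 2 := by
      obtain ⟨t, ht⟩ := hh.threshold b (hIoo b hbI)
      refine moment_two_le_of_left_eq_zero hF hq.1.1 hq.1.2 (hdes b hbI) (t := t)
        (u := c + m / moment F (h b) 1 * (1 - b)) ?_ ?_ (e0.trans (hP0 b hbI).symm)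
        (e1.trans (hP1 b hbI).symm)
      · intro x hx
        have := (hint b hbI).1
        simp only [P, twoLevel, ht.left x hx]
        field_simp
        linarith
      · intro x hx
        simp only [P, twoLevel, ht.right x hx]
    have hupp : moment F q 2 ≤ moment F (P a) 2 := by
      obtain ⟨t, ht⟩ := hh.threshold a (hIoo a haI)
      refine moment_two_le_of_right_eq_one hF hq.1.1 hq.1.2 (hdes a haI) (t := t)
        (l := c + m / moment F (h a) 1 * (0 - a)) ?_ ?_ (e0.trans (hP0 a haI).symm)
        (e1.trans (hP1 a haI).symm)
      · intro x hx
        simp only [P, twoLevel, ht.left x hx]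
      · intro x hx
        have := (hint a haI).1
        simp only [P, twoLevel, ht.right x hx]
        field_simp
        linarith
    obtain ⟨r, hr, hre⟩ : momentZ F q 2 ∈ (fun s => momentZ F (P s) 2) '' Icc a b := by
      refine intermediate_value_Icc' hab hcont ?_
      simp only [mem_Icc]
      rw [momentZ_eq hF (hdes a haI) le_rfl, momentZ_eq hF (hdes b hbI) le_rfl,
        momentZ_eq hF hq.1.1 le_rfl]
      constructor <;> linarith
    have : infoMatrix F σ q = infoMatrix F σ (P r) := by
      rw [hinfo hq, hinfo (hfeas r hr), ← hre]
    rw [this]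
    exact hmax hr
  · obtain ⟨t, ht⟩ := hh.threshold s (hIoo s hs)
    have hd : 0 ≤ m / moment F (h s) 1 := div_nonneg hmpos.le (hint s hs).1.le
    have hl : ∀ x, x < t → P s x = c + m / moment F (h s) 1 * (0 - s) := fun x hx => by
      simp only [P, twoLevel, ht.left x hx]
    have hu : ∀ x, t < x → P s x = c + m / moment F (h s) 1 * (1 - s) := fun x hx => by
      simp only [P, twoLevel, ht.right x hx]
    refine ⟨_, _, t, ?_, ?_, ?_, hl, hu⟩
    · rw [← hl (t - 1) (by linarith)]
      exact ((hdes s hs).mem_Icc _).1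
    · exact add_le_add_right (mul_le_mul_of_nonneg_left (by linarith) hd) c
    · rw [← hu (t + 1) (by linarith)]
      exact ((hdes s hs).mem_Icc _).2
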